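/- Let $\mathbb{T}=\mathbb{R}/\mathbb{Z}$ with its usual topology. For an Abelian group $G$ and a subgroup $H$ of the group $\mathrm{Hom}(G,\mathbb{T})$ of all homomorphisms $G\to\mathbb{T}$, let $\mathcal{T}_H$ denote the coarsest topology on $G$ making every $h\in H$ continuous. A group topology on $G$ is called totally bounded if for every nonempty open set $U$ there is a finite set $F\subseteq G$ with $G=F+U$. Let $G$ be an infinite Abelian group. Then there are a sequence $(x_n)_{n<\omega}$ of pairwise distinct elements of $G$ and a subgroup $H^*\subseteq\mathrm{Hom}(G,\mathbb{T})$ such that $H^*$ separates the points of $G$, $\mathcal{T}_{H^*}$ is a Hausdorff totally bounded group topology on $G$, $|H^*|=2^{|G|}$, and $x_n\to 0$ in $(G,\mathcal{T}_{H^*})$. -/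

import Mathlib

universe u

/-- `Hom(G, 𝕋)`: all (algebraic) homomorphisms from `G` to the circle group `𝕋 = ℝ / ℤ`. -/
abbrev CharHom (G : Type u) [AddCommGroup G] : Type u := G →+ UnitAddCircle

/-- The set of point-separating subgroups of `Hom(G, 𝕋)`. -/
def pointSeparatingSubgroups (G : Type u) [AddCommGroup G] : Set (AddSubgroup (CharHom G)) :=
  {H | ∀ a b : G, a ≠ b → ∃ h ∈ H, h a ≠ h b}

/-- The topology induced on `G` by a subgroup `H` of `Hom(G, 𝕋)`: the coarsest topology on `G`
for which every `h ∈ H` is continuous into `𝕋` with its usual topology. -/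
@[reducible] def inducedByChars {G : Type u} [AddCommGroup G] (H : AddSubgroup (CharHom G)) :
    TopologicalSpace G :=
  ⨅ h ∈ H, TopologicalSpace.induced (fun g : G => h g) inferInstance

/-- The set of Hausdorff totally bounded group topologies on `G`. Here a group topology is totally
bounded if finitely many translates of each nonempty open set cover `G`. -/
def totallyBoundedGroupTopologies (G : Type u) [AddCommGroup G] : Set (TopologicalSpace G) :=
  {t | @IsTopologicalAddGroup G t _ ∧ @T2Space G t ∧
    ∀ U : Set G, @IsOpen G t U → U.Nonempty →
      ∃ F : Set G, F.Finite ∧ ∀ g : G, ∃ a ∈ F, ∃ v ∈ U, g = a + v}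

/-! Take `H` to be all characters along which `x` tends to zero. Then convergence is automatic, and
`H` has at most `2 ^ #G` elements since `Hom(G, 𝕋)` has. What remains is to choose `x` so that `H`
separates points and is large.

Choose `x` in a countably infinite subgroup `C`. Null characters of `C` extend to `G` because `𝕋` is
divisible, and characters of `G ⧸ C` vanish on `x`; together they separate points once `C` is
handled. If `G` is uncountable, `#(G ⧸ C) = #G` and `two_power_mk_le_mk_charHom` already gives
enough characters of `G ⧸ C`. If `G` is countable, `exists_interlaced_sequences` builds `x` together
with rapidly decaying characters `d k`, whose subseries sums are continuum many null characters. -/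

/-! ### Independent cyclic subgroups and the number of characters -/

/-- In a compactly generated modular lattice with an independent set `s`, adding an element disjoint
from `sSup s` keeps the set independent. -/
theorem sSupIndep.insert_of_disjoint {α : Type*} [CompleteLattice α] [IsModularLattice α]
    {s : Set α} (hs : sSupIndep s) {a : α} (ha : Disjoint a (sSup s)) : sSupIndep (insert a s) := by
  intro x hx
  obtain rfl | xa := eq_or_ne x a
  · refine ha.mono_right (sSup_le_sSup ?_)
    rintro y ⟨rfl | hy, hne⟩
    · exact absurd rfl hne
    · exact hy
  · have hxs : x ∈ s := hx.resolve_left xa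
    have h : insert a s \ {x} = insert a (s \ {x}) :=
      Set.insert_sdiff_of_notMem _ (by simpa using xa.symm)
    rw [h, sSup_insert, sup_comm]
    apply (hs hxs).disjoint_sup_right_of_disjoint_sup_left (ha.mono_right _).symm
    rw [← sSup_insert, Set.insert_sdiff_singleton, Set.insert_eq_of_mem hxs]

/-- Every abelian group has an independent family of nonzero cyclic subgroups whose sum is
essential. -/
theorem exists_sSupIndep_essential (A : Type u) [AddCommGroup A] :
    ∃ s : Set (Submodule ℤ A), sSupIndep s ∧ (∀ c ∈ s, ∃ b : A, b ≠ 0 ∧ c = Submodule.span ℤ {b}) ∧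
      ∀ a : A, a ≠ 0 → ¬ Disjoint (Submodule.span ℤ {a}) (sSup s) := by
  obtain ⟨s, hs⟩ := zorn_subset
    {s : Set (Submodule ℤ A) | sSupIndep s ∧ ∀ c ∈ s, ∃ b : A, b ≠ 0 ∧ c = Submodule.span ℤ {b}}
    fun c hc hch => ⟨⋃₀ c, ⟨iSupIndep_sUnion_of_directed hch.directedOn fun s hs => (hc hs).1,
      fun a ⟨t, tc, hat⟩ => (hc tc).2 a hat⟩, fun _ => Set.subset_sUnion_of_mem⟩
  refine ⟨s, hs.prop.1, hs.prop.2, fun a ha hd => ?_⟩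
  have hmem : Submodule.span ℤ {a} ∈ s := hs.le_of_ge
    ⟨hs.prop.1.insert_of_disjoint hd, Set.forall_mem_insert.2 ⟨⟨a, ha, rfl⟩, hs.prop.2⟩⟩
    (Set.subset_insert _ _) (Set.mem_insert _ _)
  have := hd.mono_right (le_sSup hmem)
  rw [disjoint_self, Submodule.span_singleton_eq_bot] at this
  exact ha this

/-- The characters of an abelian group separate its points from zero. -/
theorem exists_character_ne_zero {A : Type*} [AddCommGroup A] {a : A} (ha : a ≠ 0) :
    ∃ χ : A →+ UnitAddCircle, χ a ≠ 0 := by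
  obtain ⟨c, hc⟩ := CharacterModule.exists_character_apply_ne_zero_of_ne_zero ha
  -- The character `c` takes values in `ℚ / ℤ`, which embeds in `ℝ / ℤ`.
  let j : AddCircle (1 : ℚ) →+ UnitAddCircle :=
    QuotientAddGroup.map _ _ (Rat.castHom ℝ).toAddMonoidHom (by
      intro x hx
      obtain ⟨n, rfl⟩ := AddSubgroup.mem_zmultiples_iff.1 hx
      exact AddSubgroup.mem_zmultiples_iff.2 ⟨n, by simp⟩)
  have hj : Function.Injective j := by
    rw [injective_iff_map_eq_zero]
    intro x hx
    induction x using QuotientAddGroup.induction_on with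
    | H x =>
      have hx' : ((x : ℝ) : UnitAddCircle) = 0 := hx
      obtain ⟨n, hn⟩ := (AddCircle.coe_eq_zero_iff _).1 hx'
      refine (AddCircle.coe_eq_zero_iff (1 : ℚ)).2 ⟨n, ?_⟩
      have : ((n : ℚ) : ℝ) = x := by simpa using hn
      simpa using (Rat.cast_injective this)
  exact ⟨j.comp c, fun h => hc (hj (h.trans (map_zero j).symm))⟩

theorem exists_extension_addMonoidHom {M N Q : Type*} [AddCommGroup M] [AddCommGroup N]
    [AddCommGroup Q] [DivisibleBy Q ℤ] (i : M →+ N) (hi : Function.Injective i) (φ : M →+ Q) :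
    ∃ f : N →+ Q, ∀ x, f (i x) = φ x := by
  obtain ⟨f, hf⟩ := (Module.Baer.of_divisible Q).extension_property_addMonoidHom i hi φ
  exact ⟨f, DFunLike.congr_fun hf⟩

/-- A countable divisible group containing a copy of every cyclic group. -/
abbrev CyclicHull : Type := ℚ × AddCircle (1 : ℚ)

instance : Countable (AddCircle (1 : ℚ)) :=
  (QuotientAddGroup.mk_surjective (s := AddSubgroup.zmultiples (1 : ℚ))).countable

/-- A cyclic group is determined by the order of a generator; `ℚ` supplies infinite order and `ℚ /
ℤ` every finite order. -/
theorem exists_injective_span_cyclicHull {A : Type*} [AddCommGroup A] (a : A) :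
    ∃ φ : Submodule.span ℤ {a} →ₗ[ℤ] CyclicHull, Function.Injective φ := by
  obtain ⟨d, hd⟩ : ∃ d : CyclicHull, addOrderOf d = addOrderOf a := by
    rcases Nat.eq_zero_or_pos (addOrderOf a) with h | h
    · refine ⟨(1, 0), ?_⟩
      rw [h, addOrderOf_eq_zero_iff']
      intro n hn h0
      have := congrArg Prod.fst h0
      simp at this
      omega
    · have : Fact ((0 : ℚ) < 1) := ⟨one_pos⟩
      refine ⟨(0, ((1 / (addOrderOf a : ℚ) : ℚ) : AddCircle (1 : ℚ))), ?_⟩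
      rw [Prod.addOrderOf_mk, addOrderOf_zero, Nat.lcm_one_left, AddCircle.addOrderOf_period_div h]
  have hker : LinearMap.ker (LinearMap.toSpanSingleton ℤ A a) =
      LinearMap.ker (LinearMap.toSpanSingleton ℤ CyclicHull d) := by
    ext n
    rw [LinearMap.mem_ker, LinearMap.mem_ker, LinearMap.toSpanSingleton_apply,
      LinearMap.toSpanSingleton_apply, ← addOrderOf_dvd_iff_zsmul_eq_zero,
      ← addOrderOf_dvd_iff_zsmul_eq_zero, hd]
  let e := LinearEquiv.ofEq _ _ (LinearMap.span_singleton_eq_range ℤ A a) ≪≫ₗ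
    (LinearMap.quotKerEquivRange <| LinearMap.toSpanSingleton ℤ A a).symm ≪≫ₗ
    Submodule.quotEquivOfEq _ _ hker ≪≫ₗ
    (LinearMap.quotKerEquivRange <| LinearMap.toSpanSingleton ℤ CyclicHull d)
  exact ⟨(Submodule.subtype _).comp e.toLinearMap, Subtype.val_injective.comp e.injective⟩

open scoped Classical in
noncomputable instance DFinsupp.divisibleByInt {ι : Type*} {M : ι → Type*}
    [∀ i, AddCommGroup (M i)] [∀ i, DivisibleBy (M i) ℤ] : DivisibleBy (Π₀ i, M i) ℤ where
  div f n := if n = 0 then 0 else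
    DFinsupp.mapRange (fun _ y => if y = 0 then 0 else DivisibleBy.div y n) (fun _ => if_pos rfl) f
  div_zero _ := if_pos rfl
  div_cancel {n} f hn := by
    ext i
    simp only [if_neg hn, DFinsupp.smul_apply, DFinsupp.mapRange_apply]
    split_ifs with h
    · simp [h]
    · exact DivisibleBy.div_cancel _ hn

open Cardinal

theorem mk_dfinsupp_countable_le {ι : Type u} {M : Type} [AddCommGroup M] [Countable M] :
    #(Π₀ _ : ι, M) ≤ max #ι ℵ₀ := by
  classical
  have e : (ι →₀ M) ≃ (Π₀ _ : ι, M) := finsuppEquivDFinsupp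
  rw [← mk_congr e]
  cases finite_or_infinite ι
  · exact (mk_le_aleph0 (α := ι →₀ M)).trans (le_max_right _ _)
  · cases subsingleton_or_nontrivial M
    · exact (mk_le_aleph0 (α := ι →₀ M)).trans (le_max_right _ _)
    · rw [Cardinal.mk_finsupp_lift_of_infinite]
      refine max_le (by simp) ?_
      exact (lift_le_aleph0.2 mk_le_aleph0).trans (le_max_right _ _)

/-- An uncountable abelian group `A` has at least `2 ^ #A` characters. -/
theorem two_power_mk_le_mk_charHom (A : Type u) [AddCommGroup A] (hA : ℵ₀ < #A) :
    (2 : Cardinal.{u}) ^ #A ≤ #(A →+ UnitAddCircle) := by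
  classical
  obtain ⟨s, hind, hcyc, hess⟩ := exists_sSupIndep_essential A
  let X := Π₀ c : s, (c : Submodule ℤ A)
  let i : X →ₗ[ℤ] A := DFinsupp.lsum ℕ fun c : s => (c : Submodule ℤ A).subtype
  have hiapp : ∀ (c : s) (y : (c : Submodule ℤ A)), i (DFinsupp.single c y) = y := by
    intro c y
    exact DFinsupp.sumAddHom_single
      (fun c : s => (c : Submodule ℤ A).subtype.toAddMonoidHom) c y
  have hi : Function.Injective i := ((sSupIndep_iff s).1 hind).dfinsupp_lsum_injective
  have hrange : ∀ y ∈ sSup s, ∃ x, i x = y := by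
    intro y hy
    rw [sSup_eq_iSup'] at hy
    exact (Submodule.mem_iSup_iff_exists_dfinsupp _ _).1 hy
  have hs : #A ≤ #s := by
    have hemb : ∀ c : s, ∃ φ : (c : Submodule ℤ A) →ₗ[ℤ] CyclicHull, Function.Injective φ := by
      rintro ⟨c, hc⟩
      obtain ⟨b, -, rfl⟩ := hcyc c hc
      exact exists_injective_span_cyclicHull b
    choose φ hφ using hemb
    let Φ : X →ₗ[ℤ] Π₀ _ : s, CyclicHull := DFinsupp.mapRange.linearMap φ
    have hΦ : Function.Injective Φ :=
      (DFinsupp.mapRange_injective (fun c => φ c) fun c => map_zero _).2 hφ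
    -- The extension is injective: its kernel meets the essential subgroup `sSup s` trivially. So
    -- `A` embeds in a group of size at most `max #s ℵ₀`.
    obtain ⟨f, hf⟩ := exists_extension_addMonoidHom i.toAddMonoidHom hi Φ.toAddMonoidHom
    have hfinj : Function.Injective f := by
      rw [injective_iff_map_eq_zero]
      intro a hfa
      by_contra ha
      refine hess a ha (Submodule.disjoint_def.2 fun y hy hys => ?_)
      obtain ⟨n, rfl⟩ := Submodule.mem_span_singleton.1 hy
      obtain ⟨x, hx⟩ := hrange _ hys
      have h1 : Φ x = 0 := by
        rw [← LinearMap.toAddMonoidHom_coe, ← hf]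
        simp [hx, hfa]
      rw [← hx, hΦ (h1.trans (map_zero _).symm), map_zero]
    have := (mk_le_of_injective hfinj).trans mk_dfinsupp_countable_le
    exact (le_max_iff.1 this).resolve_right (not_le.2 hA)
  refine (power_le_power_left two_ne_zero hs).trans ?_
  rw [← mk_set]
  have hch : ∀ c : s, ∃ (y : (c : Submodule ℤ A)) (χ : (c : Submodule ℤ A) →+ UnitAddCircle),
      χ y ≠ 0 := by
    rintro ⟨c, hc⟩
    obtain ⟨b, hb, rfl⟩ := hcyc c hc
    refine ⟨⟨b, Submodule.mem_span_singleton_self b⟩, exists_character_ne_zero ?_⟩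
    simpa [Subtype.ext_iff] using hb
  choose y χ hχ using hch
  -- By independence, a character may be prescribed on each cyclic summand separately; its support
  -- then recovers `S`.
  have hext : ∀ S : Set s, ∃ f : A →+ UnitAddCircle, ∀ c : s, f (y c) ≠ 0 ↔ c ∈ S := by
    intro S
    obtain ⟨f, hf⟩ := exists_extension_addMonoidHom i.toAddMonoidHom hi
      (DFinsupp.sumAddHom fun c => if c ∈ S then χ c else 0)
    refine ⟨f, fun c => ?_⟩
    have := hf (DFinsupp.single c (y c))
    rw [LinearMap.toAddMonoidHom_coe, hiapp, DFinsupp.sumAddHom_single] at this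
    rw [this]
    split_ifs with h <;> simp [h, hχ]
  choose F hF using hext
  refine mk_le_of_injective (f := F) fun S T hST => ?_
  ext c
  rw [← hF S, ← hF T, hST]

/-! ### Simultaneous smallness of finitely many characters -/

open Filter Topology

/-- The image of a homomorphism to a compact group is covered by finitely many translates, by
elements of the image, of a given neighbourhood of zero. -/
theorem exists_finite_cover_of_compact {G K : Type*} [AddCommGroup G] [AddCommGroup K]
    [UniformSpace K] [IsUniformAddGroup K] [CompactSpace K] (Φ : G →+ K) {V : Set K}
    (hV : V ∈ 𝓝 (0 : K)) : ∃ F : Set G, F.Finite ∧ ∀ g, ∃ a ∈ F, Φ (g - a) ∈ V := by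
  have hd : {p : K × K | p.1 - p.2 ∈ V} ∈ uniformity K := by
    rw [uniformity_eq_comap_nhds_zero_swapped]
    exact ⟨V, hV, fun _ h => h⟩
  have htb : TotallyBounded (Set.range Φ) :=
    isCompact_univ.totallyBounded.subset (Set.subset_univ _)
  obtain ⟨t, hts, htf, hcov⟩ := htb.exists_subset hd
  have hts' : ∀ y ∈ t, ∃ g, Φ g = y := hts
  choose! s hs using hts'
  refine ⟨s '' t, htf.image s, fun g => ?_⟩
  obtain ⟨y, hyt, hy⟩ := Set.mem_iUnion₂.1 (hcov ⟨g, rfl⟩)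
  exact ⟨s y, ⟨y, hyt, rfl⟩, by simpa [hs y hyt] using hy⟩

/-- In an infinite abelian group, the set of elements on which finitely many given characters are
small is infinite. -/
theorem infinite_setOf_norm_lt {G ι : Type*} [AddCommGroup G] [Infinite G]
    (S : Set ι) (hS : S.Finite) (χ : ι → G →+ UnitAddCircle) {ε : ℝ} (hε : 0 < ε) :
    {g : G | ∀ i ∈ S, ‖χ i g‖ < ε}.Infinite := by
  have := hS.fintype
  obtain ⟨F, hF, hcov⟩ := exists_finite_cover_of_compact
    (AddMonoidHom.pi fun i : S => χ i) (Metric.ball_mem_nhds 0 hε)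
  intro hfin
  refine Set.infinite_univ (α := G) ((hF.add hfin).subset fun g _ => ?_)
  obtain ⟨a, ha, h⟩ := hcov g
  refine Set.mem_add.2 ⟨a, ha, g - a, fun i hi => ?_, by abel⟩
  rw [mem_ball_zero_iff, pi_norm_lt_iff hε] at h
  exact h ⟨i, hi⟩

/-- If there were only `n` characters, each would be killed by `n`, hence take values in the finite
`n`-torsion of the circle; separation of points would then make `G` finite. -/
instance infinite_charHom (G : Type u) [AddCommGroup G] [Infinite G] : Infinite (CharHom G) := by
  by_contra hfin
  rw [not_infinite_iff_finite] at hfin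
  let n := Nat.card (CharHom G)
  let T := {u : UnitAddCircle | n • u = 0}
  have hT : T.Finite := AddCircle.finite_torsion 1 Nat.card_pos
  have := hT.to_subtype
  let e : G → CharHom G → T := fun g χ => ⟨χ g, by
    have : n • χ = 0 := card_nsmul_eq_zero'
    exact DFunLike.congr_fun this g⟩
  have he : Function.Injective e := by
    intro a b hab
    by_contra hne
    obtain ⟨χ, hχ⟩ := exists_character_ne_zero (sub_ne_zero.2 hne)
    refine hχ ?_
    rw [map_sub, sub_eq_zero]
    exact congrArg Subtype.val (congrFun hab χ)
  exact not_finite_iff_infinite.2 ‹_› (Finite.of_injective e he)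

/-! ### The countable case -/

/-- The recursive construction behind `exists_sequence_of_countable`. -/
theorem exists_interlaced_sequences {G : Type u} [AddCommGroup G] [Infinite G]
    (g : ℕ → G) (e : ℕ → CharHom G) :
    ∃ (x w : ℕ → G) (d : ℕ → CharHom G), Function.Injective x ∧ (∀ n, d n (w n) ≠ 0) ∧
      (∀ j n, j ≤ n → ‖e j (x n)‖ < (1 / 4) ^ (n + 1)) ∧
      (∀ j n, j ≤ n → ‖d n (g j)‖ < (1 / 4) ^ (n + 1)) ∧
      (∀ m n, ‖d m (x n)‖ < (1 / 4) ^ (max m n + 1)) ∧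
      ∀ m n, m < n → ‖d n (w m)‖ < (1 / 4) ^ (n + 1) * ‖d m (w m)‖ := by
  -- A stage is `(n, x, w, d)`. The label `n` strictly increases along the recursion, so it
  -- dominates the position in the sequence.
  let α := ℕ × G × G × CharHom G
  let P : α → Prop := fun p => p.2.2.2 p.2.2.1 ≠ 0 ∧
    (∀ j ≤ p.1, ‖e j p.2.1‖ < (1 / 4) ^ (p.1 + 1)) ∧
    (∀ j ≤ p.1, ‖p.2.2.2 (g j)‖ < (1 / 4) ^ (p.1 + 1)) ∧
    ‖p.2.2.2 p.2.1‖ < (1 / 4) ^ (p.1 + 1)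
  let r : α → α → Prop := fun p q => p.1 < q.1 ∧ p.2.1 ≠ q.2.1 ∧
    ‖p.2.2.2 q.2.1‖ < (1 / 4) ^ (q.1 + 1) ∧ ‖q.2.2.2 p.2.1‖ < (1 / 4) ^ (q.1 + 1) ∧
    ‖q.2.2.2 p.2.2.1‖ < (1 / 4) ^ (q.1 + 1) * ‖p.2.2.2 p.2.2.1‖
  obtain ⟨f, hP, hr⟩ := exists_seq_of_forall_finset_exists P r (by
    classical
    intro s hs
    let n := s.sup (fun p => p.1) + 1
    have hn : ∀ p ∈ s, p.1 < n := fun p hp => Nat.lt_succ_of_le (Finset.le_sup (f := Prod.fst) hp)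
    have hq : (0 : ℝ) < (1 / 4) ^ (n + 1) := by positivity
    obtain ⟨x, ⟨hxd, hxe⟩, hxs⟩ : ∃ x : G, ((∀ p ∈ s, ‖p.2.2.2 x‖ < (1 / 4) ^ (n + 1)) ∧
        ∀ j ≤ n, ‖e j x‖ < (1 / 4) ^ (n + 1)) ∧ x ∉ s.image fun p => p.2.1 := by
      let S : Set (CharHom G) := ((fun p : α => p.2.2.2) '' (s : Set α)) ∪ (e '' Set.Iic n)
      have hS : S.Finite := (s.finite_toSet.image _).union ((Set.finite_Iic n).image _)
      obtain ⟨x, hx, hxs⟩ := (infinite_setOf_norm_lt S hS id hq).exists_notMem_finset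
        (s.image fun p => p.2.1)
      exact ⟨x, ⟨fun p hp => hx _ (Or.inl ⟨p, hp, rfl⟩), fun j hj => hx _ (Or.inr ⟨j, hj, rfl⟩)⟩,
        hxs⟩
    obtain ⟨ε, hε, hεs⟩ : ∃ ε : ℝ, 0 < ε ∧ ∀ p ∈ s, ε ≤ ‖p.2.2.2 p.2.2.1‖ := by
      rcases s.eq_empty_or_nonempty with rfl | hne
      · exact ⟨1, one_pos, by simp⟩
      · obtain ⟨p, hp, hmin⟩ := s.exists_min_image (fun p => ‖p.2.2.2 p.2.2.1‖) hne
        exact ⟨_, norm_pos_iff.2 (hs p hp).1, hmin⟩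
    let δ := (1 / 4 : ℝ) ^ (n + 1) * min 1 ε
    have hδ : 0 < δ := by positivity
    have hδq : δ ≤ (1 / 4) ^ (n + 1) := mul_le_of_le_one_right hq.le (min_le_left _ _)
    let S : Set G := ((fun p : α => p.2.1) '' (s : Set α)) ∪ ((fun p : α => p.2.2.1) '' (s : Set α))
      ∪ (g '' Set.Iic n) ∪ {x}
    have hS : S.Finite := (((s.finite_toSet.image _).union (s.finite_toSet.image _)).union
      ((Set.finite_Iic n).image _)).union (Set.finite_singleton x)
    -- Duality: the smallness lemma is applied to the character group, with evaluations at points of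
    -- `S` as its characters.
    obtain ⟨d, hd, hd0⟩ := (infinite_setOf_norm_lt (G := CharHom G) S hS
      (fun a => AddMonoidHom.eval a) hδ).exists_notMem_finset {0}
    replace hd : ∀ a ∈ S, ‖d a‖ < δ := hd
    obtain ⟨w, hw⟩ : ∃ w, d w ≠ 0 := by
      by_contra! h
      exact hd0 (Finset.mem_singleton.2 (AddMonoidHom.ext h))
    refine ⟨(n, x, w, d), ⟨hw, hxe, fun j hj => ?_, ?_⟩, fun p hp => ⟨hn p hp, ?_, hxd p hp, ?_, ?_⟩⟩
    · exact (hd _ (Or.inl (Or.inr ⟨j, hj, rfl⟩))).trans_le hδq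
    · exact (hd _ (Or.inr rfl)).trans_le hδq
    · exact fun h => hxs (Finset.mem_image.2 ⟨p, hp, h⟩)
    · exact (hd _ (Or.inl (Or.inl (Or.inl ⟨p, hp, rfl⟩)))).trans_le hδq
    · refine (hd _ (Or.inl (Or.inl (Or.inr ⟨p, hp, rfl⟩)))).trans_le ?_
      exact mul_le_mul_of_nonneg_left ((min_le_right _ _).trans (hεs p hp)) hq.le)
  have hmono : StrictMono fun n => (f n).1 := fun m n h => (hr m n h).1
  have hid : ∀ n, n ≤ (f n).1 := hmono.id_le
  have hpow : ∀ n, (1 / 4 : ℝ) ^ ((f n).1 + 1) ≤ (1 / 4) ^ (n + 1) := fun n =>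
    pow_le_pow_of_le_one (by norm_num) (by norm_num) (Nat.succ_le_succ (hid n))
  refine ⟨fun n => (f n).2.1, fun n => (f n).2.2.1, fun n => (f n).2.2.2, ?_, fun n => (hP n).1,
    fun j n h => ((hP n).2.1 j (h.trans (hid n))).trans_le (hpow n),
    fun j n h => ((hP n).2.2.1 j (h.trans (hid n))).trans_le (hpow n), fun m n => ?_,
    fun m n h => (hr m n h).2.2.2.2.trans_le
      (mul_le_mul_of_nonneg_right (hpow n) (norm_nonneg _))⟩
  · intro m n h
    rcases lt_trichotomy m n with hlt | rfl | hlt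
    · exact absurd h (hr m n hlt).2.1
    · rfl
    · exact absurd h.symm (hr n m hlt).2.1
  · rcases lt_trichotomy m n with hlt | rfl | hlt
    · rw [max_eq_right hlt.le]
      exact (hr m n hlt).2.2.1.trans_le (hpow n)
    · rw [max_self]
      exact (hP m).2.2.2.trans_le (hpow m)
    · rw [max_eq_left hlt.le]
      exact (hr n m hlt).2.2.2.1.trans_le (hpow m)

/-- The subgroup of the characters along which the sequence `x` tends to zero. -/
def nullCharacters {G : Type*} [AddCommGroup G] (x : ℕ → G) : AddSubgroup (G →+ UnitAddCircle) where
  carrier := {h | Tendsto (fun n => h (x n)) atTop (𝓝 0)}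
  zero_mem' := tendsto_const_nhds
  add_mem' {a b} ha hb := by simpa using Filter.Tendsto.add (Set.mem_ofPred.1 ha) (Set.mem_ofPred.1 hb)
  neg_mem' {a} ha := by simpa using Filter.Tendsto.neg (Set.mem_ofPred.1 ha)

theorem mem_nullCharacters {G : Type*} [AddCommGroup G] {x : ℕ → G} {h : G →+ UnitAddCircle} :
    h ∈ nullCharacters x ↔ Tendsto (fun n => h (x n)) atTop (𝓝 0) := Iff.rfl

theorem hasSum_quarter_pow_succ : HasSum (fun k : ℕ => (1 / 4 : ℝ) ^ (k + 1)) (1 / 3) := by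
  have := (hasSum_geometric_of_lt_one (r := (1 / 4 : ℝ)) (by norm_num) (by norm_num)).mul_left (1/4)
  norm_num at this
  simpa only [pow_succ'] using this

/-- A countably infinite abelian group has an injective sequence that tends to zero along
a separating family of characters with a Cantor set of members. -/
theorem exists_sequence_of_countable (G : Type u) [AddCommGroup G] [Infinite G] [Countable G] :
    ∃ x : ℕ → G, Function.Injective x ∧
      (∀ a : G, a ≠ 0 → ∃ h ∈ nullCharacters x, h a ≠ 0) ∧
      ∃ φ : (ℕ → Bool) → nullCharacters x, Function.Injective φ := by
  obtain ⟨g, hg⟩ := exists_surjective_nat G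
  have hsep : ∀ j, ∃ χ : CharHom G, g j ≠ 0 → χ (g j) ≠ 0 := fun j => by
    by_cases h : g j = 0
    · exact ⟨0, fun h' => absurd h h'⟩
    · exact (exists_character_ne_zero h).imp fun χ hχ _ => hχ
  choose e he using hsep
  obtain ⟨x, w, d, hx, hdw, hex, hdg, hdx, hdwm⟩ := exists_interlaced_sequences g e
  have hq0 : Tendsto (fun n : ℕ => (1 / 4 : ℝ) ^ (n + 1)) atTop (𝓝 0) :=
    (tendsto_pow_atTop_nhds_zero_of_lt_one (by norm_num) (by norm_num)).comp (tendsto_add_atTop_nat 1)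
  refine ⟨x, hx, fun a ha => ?_, ?_⟩
  · obtain ⟨j, rfl⟩ := hg a
    refine ⟨e j, ?_, he j ha⟩
    refine squeeze_zero_norm' ?_ hq0
    filter_upwards [eventually_ge_atTop j] with n hn using (hex j n hn).le
  -- `b` selects the subseries of `∑ d k` to be summed.
  let t : (ℕ → Bool) → G → ℕ → UnitAddCircle := fun b a k => if b k then d k a else 0
  have ht : ∀ b a k, ‖t b a k‖ ≤ ‖d k a‖ := fun b a k => by
    dsimp only [t]
    split_ifs <;> simp
  have hsum : ∀ b a, Summable (t b a) := by
    intro b a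
    obtain ⟨j, rfl⟩ := hg a
    refine Summable.of_norm_bounded_eventually_nat hasSum_quarter_pow_succ.summable ?_
    filter_upwards [eventually_ge_atTop j] with k hk using (ht b _ k).trans (hdg j k hk).le
  let h : (ℕ → Bool) → CharHom G := fun b => AddMonoidHom.mk' (fun a => ∑' k, t b a k) (by
    intro a a'
    rw [← (hsum b a).tsum_add (hsum b a')]
    congr 1 with k
    dsimp only [t]
    split_ifs <;> simp)
  have hh : ∀ b a, h b a = ∑' k, t b a k := fun _ _ => rfl
  have hnull : ∀ b, h b ∈ nullCharacters x := by
    intro b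
    have h2 : Tendsto (fun n : ℕ => (1 / 2 : ℝ) ^ n * 2) atTop (𝓝 0) := by
      simpa using (tendsto_pow_atTop_nhds_zero_of_lt_one (r := (1 / 2 : ℝ))
        (by norm_num) (by norm_num)).mul_const 2
    refine squeeze_zero_norm (fun n => ?_) h2
    refine tsum_of_norm_bounded (hasSum_geometric_two.mul_left ((1 / 2 : ℝ) ^ n)) fun k => ?_
    refine (ht b _ k).trans ((hdx k n).le.trans ?_)
    -- The bound holds because `n + k ≤ 2 * (max k n + 1)`.
    rw [← pow_add, show (1 / 4 : ℝ) = (1 / 2) ^ 2 by norm_num, ← pow_mul]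
    exact pow_le_pow_of_le_one (by norm_num) (by norm_num) (by omega)
  refine ⟨fun b => ⟨h b, hnull b⟩, fun b b' hbb => ?_⟩
  by_contra hne
  have hex' : ∃ k, b k ≠ b' k := Function.ne_iff.1 hne
  classical
  -- At the first disagreement `k`, evaluate at `w k`: earlier terms cancel, term `k` has norm `‖d k
  -- (w k)‖`, and the later ones total at most a third of it.
  let k := Nat.find hex'
  have hk : b k ≠ b' k := Nat.find_spec hex'
  have hlt : ∀ j < k, b j = b' j := fun j hj => not_not.1 (Nat.find_min hex' hj)
  have heq : h b (w k) = h b' (w k) := 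
    DFunLike.congr_fun (congrArg Subtype.val hbb) _
  rw [hh, hh, ← sub_eq_zero, ← (hsum b _).tsum_sub (hsum b' _),
    ((hsum b _).sub (hsum b' _)).tsum_eq_add_tsum_ite k] at heq
  have h1 : ‖t b (w k) k - t b' (w k) k‖ = ‖d k (w k)‖ := by
    dsimp only [t]
    cases hb : b k <;> cases hb' : b' k <;> simp_all
  have h2 : ‖∑' n, ite (n = k) 0 (t b (w k) n - t b' (w k) n)‖ ≤ 1 / 3 * ‖d k (w k)‖ := by
    refine tsum_of_norm_bounded (hasSum_quarter_pow_succ.mul_right _) fun n => ?_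
    rcases lt_trichotomy n k with hn | rfl | hn
    · rw [if_neg hn.ne]
      have : t b (w k) n - t b' (w k) n = 0 := by simp [t, hlt n hn]
      rw [this, norm_zero]
      positivity
    · rw [if_pos rfl, norm_zero]
      positivity
    · rw [if_neg hn.ne']
      refine le_trans ?_ (hdwm k n hn).le
      dsimp only [t]
      split_ifs <;> simp
  have hpos : 0 < ‖d k (w k)‖ := norm_pos_iff.2 (hdw k)
  rw [← h1, eq_neg_of_add_eq_zero_left heq, norm_neg] at hpos
  rw [← h1, eq_neg_of_add_eq_zero_left heq, norm_neg] at h2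
  linarith


/-! ### The induced topology -/

/-- The evaluation map from `G` to the power of the circle indexed by `H`. -/
def evalChars {G : Type u} [AddCommGroup G] (H : AddSubgroup (CharHom G)) :
    G →+ (H → UnitAddCircle) :=
  AddMonoidHom.pi fun h : H => (h : CharHom G)

theorem inducedByChars_eq_induced {G : Type u} [AddCommGroup G] (H : AddSubgroup (CharHom G)) :
    inducedByChars H = TopologicalSpace.induced (evalChars H) Pi.topologicalSpace := by
  rw [inducedByChars, Pi.topologicalSpace, induced_iInf, iInf_subtype']
  exact iInf_congr fun h => by rw [induced_compose]; rfl

/-- Evaluation embeds `G` in a power of the circle, which is a compact Hausdorff group. -/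
theorem inducedByChars_mem_totallyBounded {G : Type u} [AddCommGroup G]
    {H : AddSubgroup (CharHom G)} (hH : H ∈ pointSeparatingSubgroups G) :
    inducedByChars H ∈ totallyBoundedGroupTopologies G := by
  rw [inducedByChars_eq_induced]
  have hinj : Function.Injective (evalChars H) := by
    intro a b hab
    by_contra hne
    obtain ⟨h, hh, hab'⟩ := hH a b hne
    exact hab' (congrFun hab ⟨h, hh⟩)
  refine ⟨topologicalAddGroup_induced _, ?_, ?_⟩
  · let := TopologicalSpace.induced (evalChars H) Pi.topologicalSpace
    exact T2Space.of_injective_continuous hinj continuous_induced_dom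
  · rintro _ ⟨V, hV, rfl⟩ ⟨u, hu⟩
    have hV0 : (fun y => evalChars H u + y) ⁻¹' V ∈ 𝓝 (0 : H → UnitAddCircle) :=
      (continuous_const_add _).continuousAt.preimage_mem_nhds
        (by simpa using hV.mem_nhds hu)
    obtain ⟨F, hF, hcov⟩ := exists_finite_cover_of_compact (evalChars H) hV0
    refine ⟨(fun a => a - u) '' F, hF.image _, fun g => ?_⟩
    obtain ⟨a, ha, hga⟩ := hcov g
    exact ⟨a - u, ⟨a, ha, rfl⟩, u + (g - a), by simpa using hga, by abel⟩

theorem tendsto_inducedByChars_nullCharacters {G : Type u} [AddCommGroup G] (x : ℕ → G) :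
    Tendsto x atTop (@nhds G (inducedByChars (nullCharacters x)) 0) := by
  rw [inducedByChars_eq_induced, nhds_induced, tendsto_comap_iff, map_zero, tendsto_pi_nhds]
  exact fun h => h.2

/-! ### Cardinalities and the general case -/

theorem mk_charHom_le (G : Type u) [AddCommGroup G] [Infinite G] : #(CharHom G) ≤ 2 ^ #G := by
  have h1 : #(CharHom G) ≤ #(G → UnitAddCircle) := mk_le_of_injective DFunLike.coe_injective
  have h2 : #UnitAddCircle ≤ 𝔠 :=
    (mk_le_of_surjective (QuotientAddGroup.mk_surjective (s := AddSubgroup.zmultiples (1 : ℝ)))).trans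
      mk_real.le
  refine h1.trans ?_
  rw [mk_arrow, lift_uzero]
  refine (power_le_power_right (lift_le.2 h2)).trans ?_
  rw [lift_continuum, ← two_power_aleph0, ← power_mul, aleph0_mul_eq (aleph0_le_mk G)]

/-- Every infinite abelian group has an injective sequence along which as many characters as
possible, separating the points, tend to zero. -/
theorem exists_sequence_nullCharacters (G : Type u) [AddCommGroup G] [Infinite G] :
    ∃ x : ℕ → G, Function.Injective x ∧ nullCharacters x ∈ pointSeparatingSubgroups G ∧
      2 ^ #G ≤ #(nullCharacters x) := by
  let y := Infinite.natEmbedding G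
  let L : (ℕ →₀ ℤ) →+ G := (Finsupp.linearCombination ℤ y).toAddMonoidHom
  let C : AddSubgroup G := L.range
  have : Countable C := L.rangeRestrict_surjective.countable
  have : Infinite C := Infinite.of_injective
    (fun n => (⟨y n, Finsupp.single n 1, by simp [L]⟩ : C))
    fun m n h => y.injective (congrArg Subtype.val h)
  obtain ⟨x, hx, hsep, φ, hφ⟩ := exists_sequence_of_countable C
  have hext : ∀ h : nullCharacters x, ∃ f : nullCharacters (fun n => (x n : G)),
      ∀ c : C, (f : CharHom G) c = (h : CharHom C) c := by
    rintro ⟨h, hh⟩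
    obtain ⟨f, hf⟩ := exists_extension_addMonoidHom C.subtype C.subtype_injective h
    refine ⟨⟨f, ?_⟩, hf⟩
    rw [mem_nullCharacters] at hh ⊢
    exact hh.congr fun n => (hf (x n)).symm
  have hquot : ∀ χ : CharHom (G ⧸ C),
      χ.comp (QuotientAddGroup.mk' C) ∈ nullCharacters fun n => (x n : G) := by
    intro χ
    refine tendsto_const_nhds.congr fun n => ?_
    have : QuotientAddGroup.mk' C (x n : G) = 0 := (QuotientAddGroup.eq_zero_iff _).2 (x n).2
    rw [AddMonoidHom.comp_apply, this, map_zero]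
  refine ⟨fun n => x n, Subtype.val_injective.comp hx, fun a b hab => ?_, ?_⟩
  · by_cases hC : a - b ∈ C
    · obtain ⟨h, hh, hne⟩ := hsep ⟨a - b, hC⟩ fun h0 => sub_ne_zero.2 hab (congrArg Subtype.val h0)
      obtain ⟨f, hf⟩ := hext ⟨h, hh⟩
      refine ⟨f, f.2, fun hfab => hne ?_⟩
      rw [← hf, map_sub, hfab, sub_self]
    · obtain ⟨χ, hχ⟩ := exists_character_ne_zero
        (mt (QuotientAddGroup.eq_zero_iff (N := C) (a - b)).1 hC)
      refine ⟨_, hquot χ, fun h => hχ ?_⟩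
      have : χ (QuotientAddGroup.mk' C (a - b)) = 0 := by
        rw [map_sub, map_sub, sub_eq_zero]
        exact h
      exact this
  · rcases (aleph0_le_mk G).eq_or_lt with hG | hG
    · choose f hf using hext
      have hinj : Function.Injective fun b => f (φ b) := by
        intro b b' hbb
        refine hφ (Subtype.ext (AddMonoidHom.ext fun c => ?_))
        rw [← hf, ← hf]
        exact DFunLike.congr_fun (congrArg Subtype.val hbb) _
      have := mk_le_of_injective (f := fun b : ULift.{u} (ℕ → Bool) => f (φ b.down))
        (hinj.comp ULift.down_injective)
      rw [← hG]
      simpa using this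
    -- From `#G = #(G ⧸ C) * ℵ₀` with `#G` uncountable, the quotient is infinite and the factor `ℵ₀`
    -- is absorbed.
    · have hq : #G = #(G ⧸ C) := by
        have h1 : #G = #(G ⧸ C) * #C := by
          rw [mul_def]
          exact mk_congr AddSubgroup.addGroupEquivQuotientProdAddSubgroup
        have hC : #C = ℵ₀ := mk_eq_aleph0 C
        rw [hC] at h1
        have h2 : ℵ₀ ≤ #(G ⧸ C) := by
          by_contra! hlt
          rw [h1] at hG
          exact absurd ((mul_le_mul' hlt.le le_rfl).trans aleph0_mul_aleph0.le) (not_le.2 hG)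
        rw [h1, mul_aleph0_eq h2]
      rw [hq] at hG ⊢
      refine (two_power_mk_le_mk_charHom _ hG).trans
        (mk_le_of_injective (f := fun χ => ⟨_, hquot χ⟩) fun χ χ' h => ?_)
      exact QuotientAddGroup.addMonoidHom_ext _ (congrArg Subtype.val h)

theorem corollary5p4 (G : Type u) [AddCommGroup G] [Infinite G] :
    ∃ (x : ℕ → G) (H : AddSubgroup (CharHom G)),
      Function.Injective x ∧
      H ∈ pointSeparatingSubgroups G ∧
      inducedByChars H ∈ totallyBoundedGroupTopologies G ∧
      Cardinal.mk H = 2 ^ Cardinal.mk G ∧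
      Filter.Tendsto x Filter.atTop (@nhds G (inducedByChars H) 0) := by
  obtain ⟨x, hx, hsep, hcard⟩ := exists_sequence_nullCharacters G
  exact ⟨x, nullCharacters x, hx, hsep, inducedByChars_mem_totallyBounded hsep,
    ((mk_set_le _).trans (mk_charHom_le G)).antisymm hcard, tendsto_inducedByChars_nullCharacters x⟩
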